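/- Let $G$ be a torsion-free, finitely presented group which is an internal semidirect product $G=\langle g\rangle\ltimes B$, with $B$ an abelian normal subgroup. Suppose that no non-trivial finitely generated subgroup $A$ of $B$ is setwise invariant under $g$, i.e. satisfies $gAg^{-1}=A$. Then $B\otimes_{\mathbb Z}\mathbb Q$ is finite-dimensional over $\mathbb Q$, and $g$ acts on $B$ with no eigenvalue of complex modulus $1$: a rational matrix representing the $\mathbb Q$-linear map that conjugation by $g$ induces on $B\otimes_{\mathbb Z}\mathbb Q$ has no complex eigenvalue $\mu$ with $|\mu|=1$. -/

import Mathlib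

open scoped TensorProduct IsMulCommutative

noncomputable section

/-- The automorphism `b ↦ g * b * g⁻¹` of the abelian normal subgroup `B`, written additively as a
`ℤ`-linear map. -/
def conjIntLinear {G : Type*} [Group G] (B : Subgroup G) [B.Normal] [IsMulCommutative B] (g : G) :
    Additive B →ₗ[ℤ] Additive B :=
  (MonoidHom.toAdditive (MulAut.conjNormal (H := B) g).toMonoidHom).toIntLinearMap

/-- The `ℚ`-linear action of `g` on `B ⊗ ℚ` by conjugation. -/
def conjRatLinear {G : Type*} [Group G] (B : Subgroup G) [B.Normal] [IsMulCommutative B] (g : G) :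
    (ℚ ⊗[ℤ] Additive B) →ₗ[ℚ] (ℚ ⊗[ℤ] Additive B) :=
  (conjIntLinear B g).baseChange ℚ

/-- `μ` is an eigenvalue of the action of `g` on `B`: it is a complex eigenvalue of a rational
matrix representing the action of `g` on the finite-dimensional space `B ⊗ ℚ`. All these matrices
are conjugate, so the choice of the basis is immaterial. -/
def IsActionEigenvalue {G : Type*} [Group G] (B : Subgroup G) [B.Normal] [IsMulCommutative B]
    (g : G) (μ : ℂ) : Prop :=
  ∃ (n : ℕ) (e : Module.Basis (Fin n) ℚ (ℚ ⊗[ℤ] Additive B)),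
    Module.End.HasEigenvalue
      (Matrix.toLin' ((LinearMap.toMatrix e e (conjRatLinear B g)).map (algebraMap ℚ ℂ))) μ

end

open scoped TensorProduct IsMulCommutative
open Filter Polynomial

/-! If `g` has infinite order, every computation in `G` already holds in the HNN extension of a
large finitely generated window of `B`. Finite presentation therefore gives a homomorphism from `G`
to one such extension. In `B`, the elements `g x g⁻¹` and `g⁻¹ y g` commute, while `not_commute`
(Britton's lemma) forbids this for their images unless conjugation by `g` or `g⁻¹` preserves the
window. Hence some `h = g^±1` maps a finitely generated `C ≤ B` into itself, and powers of `h`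
absorb `B` into `C`.

Thus `C ⊗ ℚ` is all of `B ⊗ ℚ`, and Cayley–Hamilton on `C` makes the action of `h` integral. An
eigenvalue `μ` of modulus 1 satisfies `μ⁻¹ = conj μ`, so both `μ` and `μ⁻¹` are algebraic integers.
The minimal polynomial of `μ` evaluated at `g` kills some `b ≠ 0`, and `ℤ[g] b` is a forbidden
invariant subgroup. -/

namespace ConjHNN

/-! ### HNN extensions over windows in `B` -/

variable {G : Type*} [Group G]

/-- The elements of `C` whose conjugate by `g` is again in `C`. -/
def domain (g : G) (C : Subgroup G) : Subgroup C :=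
  (C.comap (MulAut.conj g).toMonoidHom).subgroupOf C

theorem mem_domain {g : G} {C : Subgroup G} {x : C} : x ∈ domain g C ↔ g * x * g⁻¹ ∈ C := by
  simp [domain, Subgroup.mem_subgroupOf]

/-- Conjugation by `g`, as a partial automorphism of `C`. -/
def conjEquiv (g : G) (C : Subgroup G) : domain g C ≃* domain g⁻¹ C where
  toFun x := ⟨⟨g * x * g⁻¹, mem_domain.1 x.2⟩, mem_domain.2 (by simp [mul_assoc])⟩
  invFun x := ⟨⟨g⁻¹ * x * g, by simpa using mem_domain.1 x.2⟩, mem_domain.2 (by simp [mul_assoc])⟩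
  left_inv x := by ext; simp [mul_assoc]
  right_inv x := by ext; simp [mul_assoc]
  map_mul' x y := by ext; simp [mul_assoc]

/-- The HNN extension of `C` along the partial automorphism given by conjugation by `g`. -/
abbrev Ext (g : G) (C : Subgroup G) : Type _ :=
  HNNExtension C (domain g C) (domain g⁻¹ C) (conjEquiv g C)

open HNNExtension

/-- The stable letter of `Ext g C`. -/
abbrev stable (g : G) (C : Subgroup G) : Ext g C := t

/-- The element `x` of `Ext g C` is the image of the element `b` of `C`. -/
def IsImage (g : G) (C : Subgroup G) (b : G) (x : Ext g C) : Prop :=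
  ∃ y : C, (y : G) = b ∧ (of y : Ext g C) = x

variable {g : G} {C : Subgroup G}

namespace IsImage

theorem of_mem {b : G} (h : b ∈ C) : IsImage g C b (of ⟨b, h⟩) := ⟨⟨b, h⟩, rfl, rfl⟩

theorem unique {b : G} {x y : Ext g C} (hx : IsImage g C b x) (hy : IsImage g C b y) : x = y := by
  obtain ⟨u, hu, rfl⟩ := hx
  obtain ⟨v, hv, rfl⟩ := hy
  rw [Subtype.ext (hu.trans hv.symm)]

theorem one : IsImage g C 1 1 := ⟨1, rfl, map_one _⟩

theorem mul {a b : G} {x y : Ext g C} (hx : IsImage g C a x) (hy : IsImage g C b y) :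
    IsImage g C (a * b) (x * y) := by
  obtain ⟨u, rfl, rfl⟩ := hx
  obtain ⟨v, rfl, rfl⟩ := hy
  exact ⟨u * v, rfl, map_mul _ _ _⟩

theorem inv {a : G} {x : Ext g C} (hx : IsImage g C a x) : IsImage g C a⁻¹ x⁻¹ := by
  obtain ⟨u, rfl, rfl⟩ := hx
  exact ⟨u⁻¹, rfl, map_inv _ _⟩

theorem conj {b : G} {x : Ext g C} (hx : IsImage g C b x) (h : g * b * g⁻¹ ∈ C) :
    IsImage g C (g * b * g⁻¹) (stable g C * x * (stable g C)⁻¹) := by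
  obtain ⟨u, rfl, rfl⟩ := hx
  exact ⟨⟨g * u * g⁻¹, h⟩, rfl, equiv_eq_conj (φ := conjEquiv g C) ⟨u, mem_domain.2 h⟩⟩

theorem conj_inv {b : G} {x : Ext g C} (hx : IsImage g C b x) (h : g⁻¹ * b * g ∈ C) :
    IsImage g C (g⁻¹ * b * g) ((stable g C)⁻¹ * x * stable g C) := by
  obtain ⟨u, rfl, rfl⟩ := hx
  exact ⟨⟨g⁻¹ * u * g, h⟩, rfl, equiv_symm_eq_conj (φ := conjEquiv g C)
    ⟨u, mem_domain.2 (by simpa using h)⟩⟩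

end IsImage

/-- Two conjugates that leave the base group in opposite directions do not commute. -/
theorem not_commute {x y : C} (hx : x ∉ domain g C) (hy : y ∉ domain g⁻¹ C) :
    ¬ Commute (stable g C * (of x : Ext g C) * (stable g C)⁻¹)
      ((stable g C)⁻¹ * (of y : Ext g C) * stable g C) := by
  intro h
  -- Britton's lemma: equal reduced words have equal exponent sequences, but here these begin with
  -- `1` and `-1`.
  let w₁ : NormalWord.ReducedWord C (domain g C) (domain g⁻¹ C) :=
    ⟨1, [(1, x), (-1, 1), (-1, y), (1, 1)], by simp [toSubgroup, hx, hy]⟩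
  let w₂ : NormalWord.ReducedWord C (domain g C) (domain g⁻¹ C) :=
    ⟨1, [(-1, y), (1, 1), (1, x), (-1, 1)], by simp [toSubgroup, hx, hy]⟩
  have e : w₁.prod (conjEquiv g C) = w₂.prod (conjEquiv g C) := by
    simpa [w₁, w₂, NormalWord.ReducedWord.prod, mul_assoc, Commute, SemiconjBy] using h
  have := (ReducedWord.map_fst_eq_and_of_prod_eq _ e).1
  simp [w₁, w₂] at this

variable {ι : Type*}

/-- The subgroup generated by the conjugates of the `c i` by `g ^ j` with `|j| ≤ N`. -/
def window (g : G) (c : ι → G) (N : ℕ) : Subgroup G :=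
  Subgroup.closure {x | ∃ i, ∃ j : ℤ, |j| ≤ N ∧ x = g ^ j * c i * (g ^ j)⁻¹}

variable (g) (c : ι → G)

theorem conj_mem_window {N : ℕ} {j : ℤ} (hj : |j| ≤ N) (i : ι) :
    g ^ j * c i * (g ^ j)⁻¹ ∈ window g c N :=
  Subgroup.subset_closure ⟨i, j, hj, rfl⟩

theorem base_mem_window (N : ℕ) (i : ι) : c i ∈ window g c N := by
  simpa using conj_mem_window g c (N := N) (j := 0) (by simp) i

theorem window_mono : Monotone (window g c) := by
  intro M N h
  refine Subgroup.closure_mono ?_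
  rintro x ⟨i, j, hj, rfl⟩
  exact ⟨i, j, hj.trans (by exact_mod_cast h), rfl⟩

theorem window_le {B : Subgroup G} [B.Normal] (hc : ∀ i, c i ∈ B) (N : ℕ) : window g c N ≤ B := by
  refine (Subgroup.closure_le _).2 ?_
  rintro x ⟨i, j, -, rfl⟩
  exact Subgroup.Normal.conj_mem ‹_› _ (hc i) _

theorem window_fg [Finite ι] (N : ℕ) : (window g c N).FG := by
  refine (Subgroup.fg_iff _).2 ⟨_, rfl, ?_⟩
  refine ((Set.finite_univ (α := ι)).prod (Set.finite_Icc (-(N : ℤ)) N)).image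
    (fun p => g ^ p.2 * c p.1 * (g ^ p.2)⁻¹) |>.subset ?_
  rintro x ⟨i, j, hj, rfl⟩
  exact ⟨(i, j), ⟨trivial, abs_le.1 hj⟩, rfl⟩

theorem zpow_conj_mem {M : ℕ} {b : G} (hb : b ∈ window g c M) (e : ℤ) :
    g ^ e * b * (g ^ e)⁻¹ ∈ window g c (M + e.natAbs) := by
  have : window g c M ≤ (window g c (M + e.natAbs)).comap (MulAut.conj (g ^ e)).toMonoidHom := by
    refine (Subgroup.closure_le _).2 ?_
    rintro x ⟨i, j, hj, rfl⟩
    have := conj_mem_window g c (N := M + e.natAbs) (j := e + j)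
      ((abs_add_le _ _).trans (by push_cast; linarith)) i
    simpa [-map_zpow, zpow_add, mul_assoc] using this
  simpa [-map_zpow] using this hb

theorem eventually_mem {M : ℕ} {b : G} (hb : b ∈ window g c M) : ∀ᶠ N in atTop, b ∈ window g c N :=
  (eventually_ge_atTop M).mono fun _ h => window_mono g c h hb

/-- The stable letter acts by conjugation once the window is large. -/
theorem eventually_conj {M : ℕ} {b : G} (hb : b ∈ window g c M) (e : ℤ) :
    ∀ᶠ N in atTop, ∀ x, IsImage g (window g c N) b x →
      IsImage g (window g c N) (g ^ e * b * (g ^ e)⁻¹) (stable g _ ^ e * x * (stable g _ ^ e)⁻¹) := by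
  induction e using Int.induction_on with
  | zero => exact .of_forall fun N x h => by simpa using h
  | succ k ih =>
    filter_upwards [ih, eventually_mem g c (zpow_conj_mem g c hb (k + 1))] with N h h₂ x hx
    have e₁ (H : Type _) [Group H] (u v : H) : u ^ ((k : ℤ) + 1) * v * (u ^ ((k : ℤ) + 1))⁻¹ =
        u * (u ^ (k : ℤ) * v * (u ^ (k : ℤ))⁻¹) * u⁻¹ := by
      rw [add_comm, zpow_add, zpow_one]; group
    rw [e₁] at h₂ ⊢
    rw [e₁]
    exact (h x hx).conj h₂
  | pred k ih =>
    filter_upwards [ih, eventually_mem g c (zpow_conj_mem g c hb (-k - 1))] with N h h₂ x hx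
    have e₁ (H : Type _) [Group H] (u v : H) : u ^ (-(k : ℤ) - 1) * v * (u ^ (-(k : ℤ) - 1))⁻¹ =
        u⁻¹ * (u ^ (-(k : ℤ)) * v * (u ^ (-(k : ℤ)))⁻¹) * u := by
      rw [sub_eq_add_neg, add_comm, zpow_add, zpow_neg_one]; group
    rw [e₁] at h₂ ⊢
    rw [e₁]
    exact (h x hx).conj_inv h₂

/-- The lift of a presentation to the HNN extension over a window. -/
def liftFree (e : ι → ℤ) (N : ℕ) : FreeGroup ι →* Ext g (window g c N) :=
  FreeGroup.lift fun i => stable g _ ^ e i * of ⟨c i, base_mem_window g c N i⟩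

/-- Moving powers of `g` to the left uses finitely many conjugations, all available in a large
window. Hence `k` and `b` do not depend on `N`. -/
theorem eventually_liftFree (e : ι → ℤ) (f : FreeGroup ι →* G)
    (hf : ∀ i, f (FreeGroup.of i) = g ^ e i * c i) (w : FreeGroup ι) :
    ∃ (k : ℤ) (b : G) (M : ℕ), b ∈ window g c M ∧ f w = g ^ k * b ∧
      ∀ᶠ N in atTop, ∃ x, IsImage g (window g c N) b x ∧
        liftFree g c e N w = stable g _ ^ k * x := by
  induction w using FreeGroup.induction_on with
  | C1 => exact ⟨0, 1, 0, one_mem _, by simp, .of_forall fun N => ⟨1, .one, by simp⟩⟩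
  | of i => exact ⟨e i, c i, 0, base_mem_window g c 0 i, hf i, .of_forall fun N =>
      ⟨_, .of_mem (base_mem_window g c N i), by simp [liftFree]⟩⟩
  | inv_of i ih =>
    obtain ⟨k, b, M, hb, h, hN⟩ := ih
    refine ⟨-k, g ^ k * b⁻¹ * (g ^ k)⁻¹, _, zpow_conj_mem g c (inv_mem hb) k,
      by rw [map_inv, h]; group, ?_⟩
    filter_upwards [hN, eventually_conj g c (inv_mem hb) k] with N ⟨x, hx, e₁⟩ h₂
    exact ⟨_, h₂ _ hx.inv, by rw [map_inv, e₁]; group⟩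
  | mul x y hx hy =>
    obtain ⟨k, b, M, hb, h, hN⟩ := hx
    obtain ⟨k', b', M', hb', h', hN'⟩ := hy
    have m := zpow_conj_mem g c hb (-k')
    refine ⟨k + k', g ^ (-k') * b * (g ^ (-k'))⁻¹ * b', max (M + (-k').natAbs) M',
      mul_mem (window_mono g c (le_max_left _ _) m) (window_mono g c (le_max_right _ _) hb'),
      by rw [map_mul, h, h']; group, ?_⟩
    filter_upwards [hN, hN', eventually_conj g c hb (-k')] with N ⟨x, hx, e₁⟩ ⟨y, hy, e₂⟩ h₃
    exact ⟨_, (h₃ _ hx).mul hy, by rw [map_mul, e₁, e₂]; group⟩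

/-- If a finitely presented group `G` is generated by `g` and an abelian normal subgroup `B` that
meets the infinite cyclic group `⟨g⟩` trivially, then a large window is mapped into itself by
conjugation by `g` or by `g⁻¹`. -/
theorem exists_window_invariant [Finite ι] {B : Subgroup G} [B.Normal] [IsMulCommutative B]
    (hdisj : ∀ k : ℤ, g ^ k ∈ B → k = 0) (hc : ∀ i, c i ∈ B) (e : ι → ℤ) (f : FreeGroup ι →* G)
    (hf : ∀ i, f (FreeGroup.of i) = g ^ e i * c i) (hsurj : Function.Surjective f)
    (hker : f.ker.IsFinitelyNormallyGenerated) :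
    ∃ N, (∀ x ∈ window g c N, g * x * g⁻¹ ∈ window g c N) ∨
      (∀ x ∈ window g c N, g⁻¹ * x * g ∈ window g c N) := by
  obtain ⟨S, hS, hSker⟩ := hker
  -- There are finitely many relators, so one window serves them all.
  have h₁ : ∀ᶠ N in atTop, ∀ s ∈ S, liftFree g c e N s = 1 := by
    refine (Filter.eventually_all_finite hS).2 fun s hs => ?_
    obtain ⟨k, b, M, hb, h, hN⟩ := eventually_liftFree g c e f hf s
    have h0 : g ^ k * b = 1 := by
      rw [← h]; exact (hSker ▸ Subgroup.subset_normalClosure hs : s ∈ f.ker)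
    have hk : k = 0 := hdisj k (by
      rw [eq_inv_of_mul_eq_one_left h0]; exact inv_mem (window_le g c hc M hb))
    subst hk
    obtain rfl : b = 1 := by simpa using h0
    filter_upwards [hN] with N ⟨x, hx, e₁⟩
    rw [e₁, hx.unique .one]; simp
  obtain ⟨w, hw⟩ := hsurj g
  have h₂ : ∀ᶠ N in atTop, liftFree g c e N w = stable g _ := by
    obtain ⟨k, b, M, hb, h, hN⟩ := eventually_liftFree g c e f hf w
    have hk : k - 1 = 0 := hdisj _ (by
      have h' : g ^ k = g * b⁻¹ := eq_mul_inv_of_mul_eq (h.symm.trans hw)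
      rw [zpow_sub_one, h']
      exact Subgroup.Normal.conj_mem ‹_› _ (inv_mem (window_le g c hc M hb)) _)
    obtain rfl : k = 1 := by omega
    obtain rfl : b = 1 := by simpa [hw] using h
    filter_upwards [hN] with N ⟨x, hx, e₁⟩
    rw [e₁, hx.unique .one]; simp
  obtain ⟨N, h₁, h₂⟩ := (h₁.and h₂).exists
  refine ⟨N, ?_⟩
  let W := window g c N
  have hk : f.ker ≤ (liftFree g c e N).ker := by
    rw [← hSker]; exact Subgroup.normalClosure_le_normal h₁
  let σ : G →* Ext g W := f.liftOfSurjective hsurj ⟨liftFree g c e N, hk⟩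
  have hσ (w) : σ (f w) = liftFree g c e N w := f.liftOfRightInverse_comp_apply _ _ _ w
  have hσg : σ g = stable g W := by rw [← h₂, ← hσ, hw]
  have hσc (i) : IsImage g W (c i) (σ (c i)) := by
    have : c i = g ^ (-(e i)) * f (FreeGroup.of i) := by rw [hf]; group
    rw [show σ (c i) = of ⟨c i, base_mem_window g c N i⟩ by
      conv_lhs => rw [this]
      rw [map_mul, map_zpow, hσ, hσg]; simp [liftFree]]
    exact .of_mem _
  -- Conjugating one step at a time never leaves the window, since the exponents stay within `N`.
  have hσj (i) (n : ℕ) (hn : n ≤ N) :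
      IsImage g W (g ^ n * c i * (g ^ n)⁻¹) (σ (g ^ n * c i * (g ^ n)⁻¹)) ∧
      IsImage g W ((g ^ n)⁻¹ * c i * g ^ n) (σ ((g ^ n)⁻¹ * c i * g ^ n)) := by
    induction n with
    | zero => simpa using hσc i
    | succ n ih =>
      obtain ⟨i₁, i₂⟩ := ih (by omega)
      have a₁ := conj_mem_window g c (N := N) (j := n + 1) (by
        rw [abs_of_nonneg (by positivity)]; exact_mod_cast hn) i
      have a₂ := conj_mem_window g c (N := N) (j := -(n + 1)) (by
        rw [abs_neg, abs_of_nonneg (by positivity)]; exact_mod_cast hn) i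
      have e₁ : g ^ (n + 1) * c i * (g ^ (n + 1))⁻¹ = g * (g ^ n * c i * (g ^ n)⁻¹) * g⁻¹ := by
        rw [pow_succ']; group
      have e₂ : (g ^ (n + 1))⁻¹ * c i * g ^ (n + 1) = g⁻¹ * ((g ^ n)⁻¹ * c i * g ^ n) * g := by
        rw [pow_succ]; group
      rw [e₁, e₂]
      constructor
      · have := i₁.conj (by rw [← e₁]; exact_mod_cast a₁)
        simpa [hσg] using this
      · have := i₂.conj_inv (by rw [← e₂]; simpa [-neg_add_rev, zpow_neg, ← zpow_natCast] using a₂)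
        simpa [hσg] using this
  have hσW (b) (hb : b ∈ W) : IsImage g W b (σ b) := by
    induction hb using Subgroup.closure_induction with
    | one => simpa using IsImage.one
    | mul x y _ _ hx hy => simpa using hx.mul hy
    | inv x _ hx => simpa using hx.inv
    | mem x hx =>
      obtain ⟨i, j, hj, rfl⟩ := hx
      obtain ⟨n, rfl | rfl⟩ := j.eq_nat_or_neg
      · simpa using (hσj i n (by simpa using hj)).1
      · simpa using (hσj i n (by simpa using hj)).2
  by_contra! hcon
  obtain ⟨⟨x, hx, hx'⟩, y, hy, hy'⟩ := hcon
  refine not_commute (g := g) (C := W) (x := ⟨x, hx⟩) (y := ⟨y, hy⟩)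
    (by rwa [mem_domain]) (by rwa [mem_domain, inv_inv]) ?_
  rw [(IsImage.of_mem hx).unique (hσW x hx), (IsImage.of_mem hy).unique (hσW y hy), ← hσg]
  simp only [← map_inv, ← map_mul]
  refine Commute.map ?_ σ
  have hxB : g * x * g⁻¹ ∈ B := Subgroup.Normal.conj_mem ‹_› _ (window_le g c hc N hx) _
  have hyB : g⁻¹ * y * g ∈ B := by
    simpa using Subgroup.Normal.conj_mem ‹_› _ (window_le g c hc N hy) g⁻¹
  exact setLike_mul_comm hxB hyB

theorem exists_mem_window {B : Subgroup G} [B.Normal]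
    (hdisj : ∀ k : ℤ, g ^ k ∈ B → k = 0) (hc : ∀ i, c i ∈ B) (e : ι → ℤ) (f : FreeGroup ι →* G)
    (hf : ∀ i, f (FreeGroup.of i) = g ^ e i * c i) (hsurj : Function.Surjective f) {b : G}
    (hb : b ∈ B) : ∃ M, b ∈ window g c M := by
  obtain ⟨w, rfl⟩ := hsurj b
  obtain ⟨k, b, M, hb', h, -⟩ := eventually_liftFree g c e f hf w
  have hk : k = 0 := hdisj k (by
    rw [eq_mul_inv_of_mul_eq h.symm]; exact mul_mem hb (inv_mem (window_le g c hc M hb')))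
  exact ⟨M, by simpa [h, hk] using hb'⟩

/-- A window that is mapped into itself by conjugation by `h`, where `h` is `g` or `g⁻¹`, absorbs
every larger window. -/
theorem exists_pow_conj_mem {N : ℕ} {h : G} {s : ℤ} (hs : |s| = 1) (hgs : h = g ^ s)
    (hN : ∀ x ∈ window g c N, h * x * h⁻¹ ∈ window g c N) {M : ℕ} {b : G}
    (hb : b ∈ window g c M) : ∃ n : ℕ, h ^ n * b * (h ^ n)⁻¹ ∈ window g c N := by
  have hpow (n : ℕ) : ∀ x ∈ window g c N, h ^ n * x * (h ^ n)⁻¹ ∈ window g c N := by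
    induction n with
    | zero => simp
    | succ n ih =>
      intro x hx
      simpa [pow_succ', mul_assoc] using hN _ (ih x hx)
  refine ⟨M, ?_⟩
  have : window g c M ≤ (window g c N).comap (MulAut.conj (h ^ M)).toMonoidHom := by
    refine (Subgroup.closure_le _).2 ?_
    rintro x ⟨i, j, hj, rfl⟩
    have hs2 : s * s = 1 := by rw [← abs_mul_abs_self, hs, one_mul]
    -- Since `|s * j| ≤ M`, the product `h ^ M * g ^ j` is a nonnegative power of `h`.
    have h0 : 0 ≤ M + s * j := by
      have := neg_abs_le (s * j); rw [abs_mul, hs] at this; linarith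
    obtain ⟨n, hn⟩ := Int.eq_ofNat_of_zero_le h0
    have := hpow n _ (base_mem_window g c N i)
    have e : h ^ M * g ^ j = h ^ n := by
      rw [← zpow_natCast, ← zpow_natCast, ← hn, zpow_add, hgs, ← zpow_mul g s (s * j),
        ← mul_assoc, hs2, one_mul]
    simpa [-map_pow, ← e, mul_assoc] using this
  simpa [-map_pow] using this hb

end ConjHNN

open ConjHNN in
/-- A finitely presented semidirect product of an infinite cyclic group `⟨g⟩` with an abelian
group `B` is an ascending HNN extension of a finitely generated subgroup of `B`. -/
theorem exists_ascending_base {G : Type*} [Group G] (g : G) (B : Subgroup G) [B.Normal]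
    [IsMulCommutative B] (hsplit : Subgroup.IsComplement' (Subgroup.zpowers g) B)
    (hg : ¬ IsOfFinOrder g) (hfp : Group.IsFinitelyPresented G) :
    ∃ h, (h = g ∨ h = g⁻¹) ∧ ∃ C ≤ B, C.FG ∧ (∀ x ∈ C, h * x * h⁻¹ ∈ C) ∧
      ∀ b ∈ B, ∃ n : ℕ, h ^ n * b * (h ^ n)⁻¹ ∈ C := by
  obtain ⟨n, f, hsurj, hker⟩ := hfp.out
  have hdisj (k : ℤ) (hk : g ^ k ∈ B) : k = 0 := by
    have h1 : g ^ k = 1 := Subgroup.disjoint_def.1 hsplit.disjoint ⟨k, rfl⟩ hk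
    by_contra hk0
    exact hg (isOfFinOrder_iff_zpow_eq_one.2 ⟨k, hk0, h1⟩)
  have hdec (x : G) : ∃ (k : ℤ) (b : G), b ∈ B ∧ x = g ^ k * b := by
    obtain ⟨⟨⟨u, k, rfl⟩, v⟩, h⟩ := hsplit.surjective x
    exact ⟨k, v, v.2, h.symm⟩
  choose e c hc hf using fun i => hdec (f (FreeGroup.of i))
  have hex {b} (hb : b ∈ B) := exists_mem_window g c hdisj hc e f hf hsurj hb
  obtain ⟨N, h | h⟩ := exists_window_invariant g c hdisj hc e f hf hsurj hker
  · refine ⟨g, .inl rfl, _, window_le g c hc N, window_fg g c N, h, fun b hb => ?_⟩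
    obtain ⟨M, hM⟩ := hex hb
    exact exists_pow_conj_mem g c (s := 1) (by simp) (by simp) h hM
  · have h' : ∀ x ∈ window g c N, g⁻¹ * x * g⁻¹⁻¹ ∈ window g c N := by simpa using h
    refine ⟨g⁻¹, .inr rfl, _, window_le g c hc N, window_fg g c N, h', fun b hb => ?_⟩
    obtain ⟨M, hM⟩ := hex hb
    exact exists_pow_conj_mem g c (s := -1) (by simp) (by simp) h' hM

/-! ### Injective endomorphisms with an absorbing subgroup -/

section AscendingEndomorphism

variable {M : Type*} [AddCommGroup M]

/-- An injective endomorphism is integral if it maps a finitely generated subgroup into itself and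
that subgroup absorbs every element. -/
theorem isIntegral_of_absorbing {ψ : Module.End ℤ M} (hψ : Function.Injective ψ)
    {C : Submodule ℤ M} (hC : C.FG) (hmap : ∀ x ∈ C, ψ x ∈ C) (habs : ∀ x, ∃ n : ℕ, (ψ ^ n) x ∈ C) :
    IsIntegral ℤ ψ := by
  have : Module.Finite ℤ C := Module.Finite.iff_fg.2 hC
  obtain ⟨P, hP, h0⟩ := Algebra.IsIntegral.isIntegral (R := ℤ) (ψ.restrict hmap)
  refine ⟨P, hP, ?_⟩
  rw [← aeval_def] at h0 ⊢
  have key (Q : ℤ[X]) (x : C) : ((aeval (ψ.restrict hmap) Q x : C) : M) = aeval ψ Q x := by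
    induction Q using Polynomial.induction_on' generalizing x with
    | add p q hp hq => simp [hp, hq]
    | monomial n a =>
      simp only [aeval_monomial, Module.End.mul_apply, Module.algebraMap_end_apply]
      rw [Module.End.pow_restrict n hmap]; simp
  ext x
  obtain ⟨n, hn⟩ := habs x
  -- `P(ψ)` commutes with `ψ ^ n`, which moves `x` into `C`, where `P(ψ)` vanishes; injectivity then
  -- gives `P(ψ) x = 0`.
  have hinj : Function.Injective (ψ ^ n) := by
    rw [Module.End.coe_pow]; exact hψ.iterate n
  refine hinj ?_
  have h1 := key P ⟨_, hn⟩
  rw [h0] at h1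
  have h2 : (ψ ^ n) (aeval ψ P x) = aeval ψ P ((ψ ^ n) x) := by
    rw [← Module.End.mul_apply, ← Module.End.mul_apply]
    congr 1
    have := (Commute.all (X ^ n) P).map (aeval ψ)
    rw [map_pow, aeval_X] at this
    exact this.eq
  rw [h2, ← h1]; simp

/-- An injective map of the finite-dimensional `C ⊗ ℚ` into itself is onto, so nothing outside this
space can be carried into it. -/
theorem finiteDimensional_of_absorbing {ψ : Module.End ℤ M} (hψ : Function.Injective ψ)
    {C : Submodule ℤ M} (hC : C.FG) (hmap : ∀ x ∈ C, ψ x ∈ C) (habs : ∀ x, ∃ n : ℕ, (ψ ^ n) x ∈ C) :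
    FiniteDimensional ℚ (ℚ ⊗[ℤ] M) := by
  let V := ℚ ⊗[ℤ] M
  let Ψ : V →ₗ[ℚ] V := ψ.baseChange ℚ
  have hΨ : Function.Injective Ψ := Module.Flat.lTensor_preserves_injective_linearMap ψ hψ
  let W : Submodule ℚ V := C.baseChange ℚ
  have hW : W.FG := by
    obtain ⟨s, hs⟩ := hC
    classical
    refine ⟨s.image (TensorProduct.mk ℤ ℚ M 1), ?_⟩
    rw [Finset.coe_image, ← Submodule.baseChange_span, hs]
  have : FiniteDimensional ℚ W := Module.Finite.iff_fg.2 hW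
  have hWW : W ≤ W.comap Ψ := by
    rw [show W = _ from C.baseChange_eq_span ℚ, Submodule.span_le,
      ← C.baseChange_eq_span ℚ]
    rintro _ ⟨x, hx, rfl⟩
    exact Submodule.tmul_mem_baseChange_of_mem 1 (hmap x hx)
  have hsurj : Function.Surjective (Ψ.restrict hWW) :=
    LinearMap.injective_iff_surjective.1 fun x y h => Subtype.ext (hΨ (congrArg Subtype.val h))
  have hback (v : V) (n : ℕ) (h : (Ψ ^ n) v ∈ W) : v ∈ W := by
    induction n with
    | zero => simpa using h
    | succ n ih =>
      rw [pow_succ', Module.End.mul_apply] at h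
      obtain ⟨⟨w, hw⟩, e⟩ := hsurj ⟨_, h⟩
      exact ih (hΨ (congrArg Subtype.val e) ▸ hw)
  have htop : W = ⊤ := by
    rw [eq_top_iff, ← Submodule.baseChange_top, Submodule.baseChange_eq_span, Submodule.span_le]
    rintro _ ⟨x, -, rfl⟩
    obtain ⟨n, hn⟩ := habs x
    refine hback _ n ?_
    have : (Ψ ^ n) ((1 : ℚ) ⊗ₜ[ℤ] x) = 1 ⊗ₜ (ψ ^ n) x := by
      rw [← LinearMap.baseChange_pow]; rfl
    exact this ▸ Submodule.tmul_mem_baseChange_of_mem 1 hn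
  exact ⟨htop ▸ hW⟩

/-- If `μ` and `μ⁻¹` are algebraic integers and `minpoly ℤ μ` is not injective at `φ`, then some
non-trivial finitely generated subgroup is invariant under `φ`. -/
theorem exists_invariant_of_isIntegral {φ : Module.End ℤ M} {μ : ℂ} (hμ0 : μ ≠ 0)
    (hμ : IsIntegral ℤ μ) (hμi : IsIntegral ℤ μ⁻¹)
    (hker : ¬ Function.Injective (aeval φ (minpoly ℤ μ))) :
    ∃ A : Submodule ℤ M, A.FG ∧ A.map φ = A ∧ A ≠ ⊥ := by
  set p := minpoly ℤ μ with hp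
  have hmonic : p.Monic := minpoly.monic hμ
  obtain ⟨b, hb, hb0⟩ : ∃ b, aeval φ p b = 0 ∧ b ≠ 0 := by
    rw [injective_iff_map_eq_zero] at hker
    push Not at hker
    simpa using hker
  -- The reverse of a monic polynomial killing `μ⁻¹` kills `μ` and has constant term 1. So `X` is a
  -- unit modulo `p`, with inverse `-r`.
  obtain ⟨r, hr⟩ : ∃ r : ℤ[X], p ∣ X * r + 1 := by
    obtain ⟨Q, hQ, hQ0⟩ := hμi
    refine ⟨Q.reverse.divX, ?_⟩
    have h1 : Q.reverse.coeff 0 = 1 := by rw [coeff_zero_reverse, hQ.leadingCoeff]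
    have h2 : X * Q.reverse.divX + 1 = Q.reverse := by
      conv_rhs => rw [← X_mul_divX_add Q.reverse, h1]
      simp
    rw [h2]
    refine minpoly.isIntegrallyClosed_dvd hμ ?_
    let := invertibleOfNonzero (inv_ne_zero hμ0)
    have := (eval₂_reverse_eq_zero_iff (algebraMap ℤ ℂ) μ⁻¹ Q).2 hQ0
    simpa [aeval_def] using this
  -- The range of `T` is `ℤ[φ] b`; division by the monic `p` makes it finitely generated.
  let T : ℤ[X] →ₗ[ℤ] M := LinearMap.applyₗ b ∘ₗ (aeval φ).toLinearMap
  have hT (q) : T q = aeval φ q b := rfl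
  have hTp (q) : T (p * q) = 0 := by
    rw [hT, mul_comm, map_mul, Module.End.mul_apply, hb, map_zero]
  have hTX (q) : φ (T q) = T (X * q) := by simp [hT]
  refine ⟨LinearMap.range T, ?_, le_antisymm ?_ ?_, ?_⟩
  · have : LinearMap.range T = (degreeLT ℤ p.natDegree).map T := by
      refine le_antisymm ?_ LinearMap.map_le_range
      rintro _ ⟨q, rfl⟩
      refine ⟨q %ₘ p, ?_, ?_⟩
      · rw [SetLike.mem_coe, mem_degreeLT, ← degree_eq_natDegree hmonic.ne_zero]
        exact degree_modByMonic_lt q hmonic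
      · conv_rhs => rw [← modByMonic_add_div q p, map_add, hTp, add_zero]
    rw [this]
    exact Submodule.FG.map _ (Module.Finite.iff_fg.1 inferInstance)
  · rintro _ ⟨_, ⟨q, rfl⟩, rfl⟩
    exact ⟨X * q, (hTX q).symm⟩
  · rintro _ ⟨q, rfl⟩
    refine ⟨T (-(r * q)), ⟨_, rfl⟩, ?_⟩
    obtain ⟨s, hs⟩ := hr
    have : q = X * (-(r * q)) + p * (s * q) := by rw [← mul_assoc, ← hs]; ring
    rw [hTX]
    conv_rhs => rw [this, map_add, hTp, add_zero]
  · intro h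
    refine hb0 ?_
    have : T 1 ∈ LinearMap.range T := ⟨1, rfl⟩
    rw [h, Submodule.mem_bot] at this
    simpa [hT] using this

end AscendingEndomorphism

/-! ### Complex eigenvalues and integrality -/

section Eigenvalue

variable {M : Type*} [AddCommGroup M] {n : ℕ} (e : Module.Basis (Fin n) ℚ (ℚ ⊗[ℤ] M))

/-- The complex matrix by which an endomorphism of `M` acts on `M ⊗ ℚ`, as an endomorphism of
`ℂⁿ`. -/
noncomputable def complexAction : Module.End ℤ M →+* Module.End ℂ (Fin n → ℂ) :=
  (Matrix.toLinAlgEquiv' (R := ℂ) (n := Fin n)).toRingHom.comp <|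
    (algebraMap ℚ ℂ).mapMatrix.comp <|
      (LinearMap.toMatrixAlgEquiv e).toRingHom.comp (Module.End.baseChangeHom ℤ ℚ M).toRingHom

variable {e}

theorem aeval_complexAction {f : Module.End ℤ M} {μ : ℂ} {v : Fin n → ℂ}
    (h : complexAction e f v = μ • v) (P : ℤ[X]) :
    complexAction e (aeval f P) v = aeval μ P • v := by
  have h1 : complexAction e (aeval f P) = aeval (complexAction e f) P :=
    (aeval_algHom_apply (complexAction e).toIntAlgHom f P).symm
  rw [h1]
  clear h1
  induction P using Polynomial.induction_on' with
  | add p q hp hq => simp [add_smul, hp, hq]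
  | monomial k a =>
    have hk : (complexAction e f ^ k) v = μ ^ k • v := by
      induction k with
      | zero => simp
      | succ k ih => rw [pow_succ, Module.End.mul_apply, h, map_smul, ih, smul_smul, pow_succ']
    rw [aeval_monomial, aeval_monomial, Module.End.mul_apply, hk, Module.algebraMap_end_apply,
      mul_smul, algebraMap_int_eq, eq_intCast, Int.cast_smul_eq_zsmul]

theorem isIntegral_of_eigenvector {f : Module.End ℤ M} (hf : IsIntegral ℤ f) {μ : ℂ}
    {v : Fin n → ℂ} (hv : v ≠ 0) (h : complexAction e f v = μ • v) : IsIntegral ℤ μ := by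
  obtain ⟨P, hP, h0⟩ := hf
  refine ⟨P, hP, ?_⟩
  rw [← aeval_def] at h0 ⊢
  have := aeval_complexAction h P
  rw [h0, map_zero, LinearMap.zero_apply] at this
  exact (smul_eq_zero.1 this.symm).resolve_right hv

/-- By flatness `f` stays injective over `ℚ`, hence is a unit in finite dimension, and ring
homomorphisms preserve units. -/
theorem complexAction_injective_of_injective {f : Module.End ℤ M} (hf : Function.Injective f) :
    Function.Injective (complexAction e f) := by
  have h1 : Function.Injective (f.baseChange ℚ) :=
    Module.Flat.lTensor_preserves_injective_linearMap f hf
  have : FiniteDimensional ℚ (ℚ ⊗[ℤ] M) := Module.Finite.of_basis e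
  have h2 : IsUnit (Module.End.baseChangeHom ℤ ℚ M f) :=
    (Module.End.isUnit_iff _).2 ⟨h1, LinearMap.injective_iff_surjective.1 h1⟩
  have h3 : IsUnit (complexAction e f) :=
    ((h2.map (LinearMap.toMatrixAlgEquiv e)).map (algebraMap ℚ ℂ).mapMatrix).map
      (Matrix.toLinAlgEquiv' (R := ℂ) (n := Fin n))
  exact ((Module.End.isUnit_iff _).1 h3).1

/-- If `φ` or its inverse is integral and `φ` has an eigenvalue of modulus `1` on `M ⊗ ℚ`, then some
non-trivial finitely generated subgroup of `M` is invariant under `φ`. -/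
theorem exists_invariant_of_norm_eq_one {φ φ' : Module.End ℤ M} (hφ : φ' * φ = 1)
    (hint : IsIntegral ℤ φ ∨ IsIntegral ℤ φ') {μ : ℂ} (hμ : ‖μ‖ = 1) {v : Fin n → ℂ} (hv : v ≠ 0)
    (h : complexAction e φ v = μ • v) :
    ∃ A : Submodule ℤ M, A.FG ∧ A.map φ = A ∧ A ≠ ⊥ := by
  have hμ0 : μ ≠ 0 := by rintro rfl; simp at hμ
  have hconj : (starRingEnd ℂ).toIntAlgHom μ = μ⁻¹ := (Complex.inv_eq_conj hμ).symm
  have hconj' : (starRingEnd ℂ).toIntAlgHom μ⁻¹ = μ := by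
    rw [← hconj]; exact Complex.conj_conj μ
  have h' : complexAction e φ' v = μ⁻¹ • v := by
    have : complexAction e φ' (complexAction e φ v) = v := by
      rw [← Module.End.mul_apply, ← map_mul, hφ, map_one, Module.End.one_apply]
    rw [h, map_smul] at this
    rw [← this, smul_smul, inv_mul_cancel₀ hμ0, one_smul, this]
  have hboth : IsIntegral ℤ μ ∧ IsIntegral ℤ μ⁻¹ := by
    rcases hint with hi | hi
    · have := isIntegral_of_eigenvector hi hv h
      exact ⟨this, hconj ▸ this.map _⟩
    · have := isIntegral_of_eigenvector hi hv h'
      exact ⟨hconj' ▸ this.map _, this⟩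
  refine exists_invariant_of_isIntegral hμ0 hboth.1 hboth.2 fun hinj => hv ?_
  refine complexAction_injective_of_injective (e := e) hinj ?_
  rw [aeval_complexAction h, minpoly.aeval, zero_smul, map_zero]

end Eigenvalue

theorem hasEigenvector_complexAction {G : Type*} [Group G] {B : Subgroup G} [B.Normal]
    [IsMulCommutative B] {g : G} {μ : ℂ} (h : IsActionEigenvalue B g μ) :
    ∃ (n : ℕ) (e : Module.Basis (Fin n) ℚ (ℚ ⊗[ℤ] Additive B)) (v : Fin n → ℂ),
      v ≠ 0 ∧ complexAction e (conjIntLinear B g) v = μ • v := by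
  obtain ⟨n, e, h⟩ := h
  obtain ⟨v, hv⟩ := h.exists_hasEigenvector
  exact ⟨n, e, v, hv.2, hv.apply_eq_smul⟩

/-! ### Subgroups of `B` as `ℤ`-submodules -/

section AdditiveSubmodule

variable {G : Type*} [Group G] {B : Subgroup G} [IsMulCommutative B]

/-- A subgroup of `B`, as a `ℤ`-submodule of `B` in additive notation. -/
def additiveSubmodule (C : Subgroup G) (B : Subgroup G) [IsMulCommutative B] :
    Submodule ℤ (Additive B) :=
  AddSubgroup.toIntSubmodule (Subgroup.toAddSubgroup (C.subgroupOf B))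

theorem additiveSubmodule_fg {C : Subgroup G} (hCB : C ≤ B) (hC : C.FG) :
    (additiveSubmodule C B).FG := by
  have h1 : (C.subgroupOf B).FG := by
    rw [← Group.fg_iff_subgroup_fg] at hC ⊢
    exact Group.fg_of_surjective (f := (Subgroup.subgroupOfEquivOfLe hCB).symm.toMonoidHom)
      (Subgroup.subgroupOfEquivOfLe hCB).symm.surjective
  rw [additiveSubmodule, Submodule.fg_iff_addSubgroup_fg]
  exact (Subgroup.fg_iff_add_fg _).1 h1

end AdditiveSubmodule

section Conj

variable {G : Type*} [Group G] {B : Subgroup G} [B.Normal] [IsMulCommutative B]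

theorem conjIntLinear_apply (g : G) (b : Additive B) :
    ((conjIntLinear B g b).toMul : G) = g * b.toMul * g⁻¹ := rfl

theorem conjIntLinear_mul (g h : G) :
    conjIntLinear B (g * h) = conjIntLinear B g * conjIntLinear B h := by
  refine LinearMap.ext fun b => Additive.toMul.injective (Subtype.ext ?_)
  simp [conjIntLinear_apply, mul_assoc]

theorem conjIntLinear_one : conjIntLinear B (1 : G) = 1 := by
  refine LinearMap.ext fun b => Additive.toMul.injective (Subtype.ext ?_)
  simp [conjIntLinear_apply]

theorem conjIntLinear_pow (g : G) (n : ℕ) : conjIntLinear B (g ^ n) = conjIntLinear B g ^ n := by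
  induction n with
  | zero => simp [conjIntLinear_one]
  | succ n ih => rw [pow_succ, pow_succ, conjIntLinear_mul, ih]

theorem conjIntLinear_injective (g : G) : Function.Injective (conjIntLinear B g) := by
  refine Function.LeftInverse.injective (g := conjIntLinear B g⁻¹) fun b => ?_
  rw [← Module.End.mul_apply, ← conjIntLinear_mul, inv_mul_cancel, conjIntLinear_one]; rfl

theorem exists_subgroup_of_submodule {A : Submodule ℤ (Additive B)} (hA : A.FG) {g : G}
    (hmap : A.map (conjIntLinear B g) = A) (hne : A ≠ ⊥) :
    ∃ A' : Subgroup G, A' ≤ B ∧ A'.FG ∧ A'.map (MulAut.conj g).toMonoidHom = A' ∧ A' ≠ ⊥ := by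
  let A₁ : Subgroup B := AddSubgroup.toSubgroup' A.toAddSubgroup
  obtain ⟨S, hS, hSfin⟩ := (Subgroup.fg_iff A₁).1
    ((Subgroup.fg_iff_add_fg _).2 ((Submodule.fg_iff_addSubgroup_fg A).1 hA))
  refine ⟨A₁.map B.subtype, Subgroup.map_subtype_le _, (Subgroup.fg_iff _).2
    ⟨B.subtype '' S, by rw [← MonoidHom.map_closure, hS], hSfin.image _⟩, ?_, ?_⟩
  · ext x
    constructor
    · rintro ⟨_, ⟨b, hb, rfl⟩, rfl⟩
      refine ⟨MulAut.conjNormal g b, ?_, by simp⟩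
      have : conjIntLinear B g (Additive.ofMul b) ∈ A.map (conjIntLinear B g) := ⟨_, hb, rfl⟩
      rwa [hmap] at this
    · rintro ⟨b, hb, rfl⟩
      have h : Additive.ofMul b ∈ A := hb
      rw [← hmap] at h
      obtain ⟨c, hc, e⟩ := h
      refine ⟨_, ⟨c.toMul, hc, rfl⟩, ?_⟩
      exact congrArg (fun z : Additive B => (z.toMul : G)) e
  · intro h
    refine hne ((Submodule.eq_bot_iff _).2 fun x hx => ?_)
    have : (x.toMul : G) ∈ A₁.map B.subtype := ⟨x.toMul, hx, rfl⟩
    rw [h, Subgroup.mem_bot] at this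
    exact Additive.toMul.injective (Subtype.ext this)

end Conj

/-! ### The main theorem -/

theorem theoremB {G : Type*} [Group G] (g : G) (B : Subgroup G) [B.Normal] [IsMulCommutative B]
    (hsplit : Subgroup.IsComplement' (Subgroup.zpowers g) B)
    (htf : ∀ x : G, IsOfFinOrder x → x = 1)
    (hfp : Group.IsFinitelyPresented G)
    (hinv : ∀ A : Subgroup G, A ≤ B → A.FG →
      A.map (MulAut.conj g).toMonoidHom = A → A = ⊥) :
    FiniteDimensional ℚ (ℚ ⊗[ℤ] Additive B) ∧
      ∀ μ : ℂ, IsActionEigenvalue B g μ → ‖μ‖ ≠ 1 := by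
  obtain ⟨h, hh, C, hCB, hC, hmap, habs⟩ : ∃ h, (h = g ∨ h = g⁻¹) ∧ ∃ C ≤ B, C.FG ∧
      (∀ x ∈ C, h * x * h⁻¹ ∈ C) ∧ ∀ b ∈ B, ∃ n : ℕ, h ^ n * b * (h ^ n)⁻¹ ∈ C := by
    -- If `g` has finite order, it is trivial; then `B = G` is finitely generated and serves as `C`.
    by_cases hg : IsOfFinOrder g
    · obtain rfl := htf g hg
      have hB : B = ⊤ := by simpa using hsplit
      have hG : Group.FG G := by
        obtain ⟨n, f, hf, -⟩ := hfp.out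
        exact Group.fg_of_surjective hf
      exact ⟨1, .inl rfl, B, le_rfl, hB ▸ Group.fg_def.1 hG, by simp, by simp⟩
    · exact exists_ascending_base g B hsplit hg hfp
  have hψ := conjIntLinear_injective (B := B) h
  have hC' := additiveSubmodule_fg hCB hC
  have hmap' : ∀ x ∈ additiveSubmodule C B, conjIntLinear B h x ∈ additiveSubmodule C B :=
    fun x hx => hmap _ hx
  have habs' (x : Additive B) : ∃ n : ℕ, (conjIntLinear B h ^ n) x ∈ additiveSubmodule C B := by
    obtain ⟨n, hn⟩ := habs _ x.toMul.2
    exact ⟨n, by rw [← conjIntLinear_pow]; exact hn⟩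
  refine ⟨finiteDimensional_of_absorbing hψ hC' hmap' habs', fun μ hμ hμ1 => ?_⟩
  have hint := isIntegral_of_absorbing hψ hC' hmap' habs'
  obtain ⟨n, e, v, hv, hvμ⟩ := hasEigenvector_complexAction hμ
  obtain ⟨A, hA, hAmap, hAne⟩ := exists_invariant_of_norm_eq_one (φ' := conjIntLinear B g⁻¹)
    (by rw [← conjIntLinear_mul, inv_mul_cancel, conjIntLinear_one])
    (hh.imp (by rintro rfl; exact hint) (by rintro rfl; exact hint)) hμ1 hv hvμ
  obtain ⟨A', hA'B, hA', hA'map, hA'ne⟩ := exists_subgroup_of_submodule hA hAmap hAne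
  exact hA'ne (hinv A' hA'B hA' hA'map)
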